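/- Let $d\ge 3$. For $n\in\mathbb N$ define the following, where each maximum is taken over all sets of $n$ points in $\mathbb R^d$ and all strictly convex norms on $\mathbb R^d$: $W_d(n)$ is the maximum number of pairwise nonparallel segments of unit length with endpoints in the set; $U_d(n)$ is the maximum number of unordered pairs of points of the set at distance $1$; $D_d(n)$ is the maximum number of unordered pairs of distinct points of the set whose distance equals the diameter of the set (distances and diameter being measured in the norm). A family $(A_i)_{i\in I}$ of sets of points in $\mathbb R^d$ is called strictly antipodal if for any $i\ne j$ in $I$ and any $p\in A_i$, $q\in A_j$ there is a linear functional $\varphi:\mathbb R^d\to\mathbb R$ such that $\varphi(p)<\varphi(r)<\varphi(q)$ for every $r\in\bigcup_{l\in I}A_l\setminus\{p,q\}$. Then there is a largest integer $k$ such that for each $m$ there exists a strictly antipodal family of $k$ sets in $\mathbb R^d$, each of size at least $m$; and, denoting it by $a(d)$, \[\lim_{n\to\infty}\frac{W_d(n)}{n^2}=\lim_{n\to\infty}\frac{U_d(n)}{n^2}=\lim_{n\to\infty}\frac{D_d(n)}{n^2}=\frac12\left(1-\frac1{a(d)}\right),\] where all three limits exist. -/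

import Mathlib

open Filter Topology

noncomputable section

/-- `ℝ^d` as a real vector space. (Its Euclidean norm plays no role in the definitions below;
the norms that matter are the seminorms `N` with `IsStrictlyConvexNorm N`.) -/
abbrev Rd (d : ℕ) : Type := EuclideanSpace ℝ (Fin d)

/-- `N` is a strictly convex norm on `ℝ^d`: it is definite, and its unit sphere contains no
midpoint of two distinct points of the unit sphere. -/
structure IsStrictlyConvexNorm {d : ℕ} (N : Seminorm ℝ (Rd d)) : Prop where
  eq_zero_of_map_eq_zero : ∀ x, N x = 0 → x = 0
  map_add_lt_two : ∀ x y, N x = 1 → N y = 1 → x ≠ y → N (x + y) < 2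

/-- The length `N (p - q)` of the segment with unordered pair of endpoints `s(p, q)`. -/
def pairLength {d : ℕ} (N : Seminorm ℝ (Rd d)) : Sym2 (Rd d) → ℝ :=
  Sym2.lift ⟨fun p q => N (p - q), fun p q => map_sub_rev N p q⟩

/-- The direction (linear span of the difference of the endpoints) of the segment with unordered
pair of endpoints `s(p, q)`. Two nondegenerate segments are parallel iff their directions are
equal. -/
def pairDirection {d : ℕ} : Sym2 (Rd d) → Submodule ℝ (Rd d) :=
  Sym2.lift ⟨fun p q => Submodule.span ℝ {p - q}, fun p q => by
    change Submodule.span ℝ {p - q} = Submodule.span ℝ {q - p}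
    rw [← neg_sub q p, ← Set.neg_singleton, Submodule.span_neg]⟩

/-- The diameter of a finite point set with respect to `N`. -/
def normDiam {d : ℕ} (N : Seminorm ℝ (Rd d)) (P : Finset (Rd d)) : ℝ :=
  sSup (pairLength N '' (P.sym2 : Set (Sym2 (Rd d))))

open Classical in
/-- The unordered pairs of points of `P` at `N`-distance one. -/
def unitPairs {d : ℕ} (N : Seminorm ℝ (Rd d)) (P : Finset (Rd d)) : Finset (Sym2 (Rd d)) :=
  P.sym2.filter fun e => pairLength N e = 1

open Classical in
/-- The unordered pairs of distinct points of `P` whose `N`-distance is the diameter of `P`. -/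
def diameterPairs {d : ℕ} (N : Seminorm ℝ (Rd d)) (P : Finset (Rd d)) : Finset (Sym2 (Rd d)) :=
  P.sym2.filter fun e => ¬ e.IsDiag ∧ pairLength N e = normDiam N P

/-- `W_d(n)`: the maximum number of pairwise nonparallel segments of unit length among a set of
`n` points in `ℝ^d`, over all such sets and all strictly convex norms. -/
def maxNonparallelUnitPairs (d n : ℕ) : ℕ :=
  sSup {m | ∃ N : Seminorm ℝ (Rd d), IsStrictlyConvexNorm N ∧
    ∃ P : Finset (Rd d), P.card = n ∧
      ∃ F : Finset (Sym2 (Rd d)), F ⊆ unitPairs N P ∧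
        (F : Set (Sym2 (Rd d))).Pairwise (fun e f => pairDirection e ≠ pairDirection f) ∧
        F.card = m}

/-- `U_d(n)`: the maximum number of unit distance pairs among a set of `n` points in `ℝ^d`, over
all such sets and all strictly convex norms. -/
def maxUnitPairs (d n : ℕ) : ℕ :=
  sSup {m | ∃ N : Seminorm ℝ (Rd d), IsStrictlyConvexNorm N ∧
    ∃ P : Finset (Rd d), P.card = n ∧ (unitPairs N P).card = m}

/-- `D_d(n)`: the maximum number of diameter pairs of a set of `n` points in `ℝ^d`, over all such
sets and all strictly convex norms. -/
def maxDiameterPairs (d n : ℕ) : ℕ :=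
  sSup {m | ∃ N : Seminorm ℝ (Rd d), IsStrictlyConvexNorm N ∧
    ∃ P : Finset (Rd d), P.card = n ∧ (diameterPairs N P).card = m}

/-- A family of sets is strictly antipodal if any two points `p`, `q` in members of the family
with different indices are strictly separated from all other points of the union by a pair of
parallel hyperplanes through `p` and `q`. -/
def StrictlyAntipodal {d : ℕ} {ι : Type*} (A : ι → Set (Rd d)) : Prop :=
  ∀ i j, i ≠ j → ∀ p ∈ A i, ∀ q ∈ A j, ∃ φ : Rd d →ₗ[ℝ] ℝ,
    ∀ r ∈ (⋃ l, A l) \ {p, q}, φ p < φ r ∧ φ r < φ q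

/-- The numbers `k` such that for each `m` there is a strictly antipodal family of `k` sets in
`ℝ^d`, each of size at least `m`. -/
def antipodalSizes (d : ℕ) : Set ℕ :=
  {k | ∀ m : ℕ, ∃ A : Fin k → Set (Rd d), StrictlyAntipodal A ∧ ∀ i, (m : ℕ∞) ≤ (A i).encard}

/-- `a(d)`: the largest element of `antipodalSizes d`. -/
def antipodalNumber (d : ℕ) : ℕ := sSup (antipodalSizes d)

/-- The Euclidean norm is a strictly convex norm. -/
theorem isStrictlyConvexNorm_normSeminorm (d : ℕ) :
    IsStrictlyConvexNorm (normSeminorm ℝ (Rd d)) where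
  eq_zero_of_map_eq_zero := fun x hx => norm_eq_zero.mp hx
  map_add_lt_two := fun x y hx hy hxy => by
    have hx' : ‖x‖ = 1 := hx
    have hy' : ‖y‖ = 1 := hy
    change ‖x + y‖ < 2
    have h := parallelogram_law_with_norm ℝ x y
    have h0 : 0 < ‖x - y‖ := norm_pos_iff.mpr (sub_ne_zero.mpr hxy)
    rw [hx', hy'] at h
    nlinarith [norm_nonneg (x + y)]

/-- The maximum in the definition of `W_d(n)` is attained. -/
theorem isGreatest_maxNonparallelUnitPairs {d : ℕ} (hd : 1 ≤ d) (n : ℕ) :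
    IsGreatest {m | ∃ N : Seminorm ℝ (Rd d), IsStrictlyConvexNorm N ∧
      ∃ P : Finset (Rd d), P.card = n ∧
        ∃ F : Finset (Sym2 (Rd d)), F ⊆ unitPairs N P ∧
          (F : Set (Sym2 (Rd d))).Pairwise (fun e f => pairDirection e ≠ pairDirection f) ∧
          F.card = m} (maxNonparallelUnitPairs d n) := by
  have : Nonempty (Fin d) := ⟨⟨0, hd⟩⟩
  obtain ⟨P, hP⟩ := Infinite.exists_subset_card_eq (Rd d) n
  have hb : BddAbove {m | ∃ N : Seminorm ℝ (Rd d), IsStrictlyConvexNorm N ∧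
      ∃ P : Finset (Rd d), P.card = n ∧
        ∃ F : Finset (Sym2 (Rd d)), F ⊆ unitPairs N P ∧
          (F : Set (Sym2 (Rd d))).Pairwise (fun e f => pairDirection e ≠ pairDirection f) ∧
          F.card = m} := by
    refine ⟨(n + 1).choose 2, ?_⟩
    rintro m ⟨N, -, P, rfl, F, hF, -, rfl⟩
    exact (Finset.card_le_card (hF.trans (Finset.filter_subset _ _))).trans P.card_sym2.le
  exact ⟨Nat.sSup_mem ⟨0, normSeminorm ℝ (Rd d), isStrictlyConvexNorm_normSeminorm d, P, hP, ∅,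
    by simp⟩ hb, fun m hm => le_csSup hb hm⟩

/-- The maximum in the definition of `U_d(n)` is attained. -/
theorem isGreatest_maxUnitPairs {d : ℕ} (hd : 1 ≤ d) (n : ℕ) :
    IsGreatest {m | ∃ N : Seminorm ℝ (Rd d), IsStrictlyConvexNorm N ∧
      ∃ P : Finset (Rd d), P.card = n ∧ (unitPairs N P).card = m} (maxUnitPairs d n) := by
  have : Nonempty (Fin d) := ⟨⟨0, hd⟩⟩
  obtain ⟨P, hP⟩ := Infinite.exists_subset_card_eq (Rd d) n
  have hb : BddAbove {m | ∃ N : Seminorm ℝ (Rd d), IsStrictlyConvexNorm N ∧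
      ∃ P : Finset (Rd d), P.card = n ∧ (unitPairs N P).card = m} := by
    refine ⟨(n + 1).choose 2, ?_⟩
    rintro m ⟨N, -, P, rfl, rfl⟩
    exact (Finset.card_le_card (Finset.filter_subset _ _)).trans P.card_sym2.le
  exact ⟨Nat.sSup_mem ⟨_, normSeminorm ℝ (Rd d), isStrictlyConvexNorm_normSeminorm d, P, hP, rfl⟩
    hb, fun m hm => le_csSup hb hm⟩

/-- The maximum in the definition of `D_d(n)` is attained. -/
theorem isGreatest_maxDiameterPairs {d : ℕ} (hd : 1 ≤ d) (n : ℕ) :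
    IsGreatest {m | ∃ N : Seminorm ℝ (Rd d), IsStrictlyConvexNorm N ∧
      ∃ P : Finset (Rd d), P.card = n ∧ (diameterPairs N P).card = m} (maxDiameterPairs d n) := by
  have : Nonempty (Fin d) := ⟨⟨0, hd⟩⟩
  obtain ⟨P, hP⟩ := Infinite.exists_subset_card_eq (Rd d) n
  have hb : BddAbove {m | ∃ N : Seminorm ℝ (Rd d), IsStrictlyConvexNorm N ∧
      ∃ P : Finset (Rd d), P.card = n ∧ (diameterPairs N P).card = m} := by
    refine ⟨(n + 1).choose 2, ?_⟩
    rintro m ⟨N, -, P, rfl, rfl⟩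
    exact (Finset.card_le_card (Finset.filter_subset _ _)).trans P.card_sym2.le
  exact ⟨Nat.sSup_mem ⟨_, normSeminorm ℝ (Rd d), isStrictlyConvexNorm_normSeminorm d, P, hP, rfl⟩
    hb, fun m hm => le_csSup hb hm⟩

end

/-! Write `a` for the largest antipodal size and `T(n, a)` for the Turán graph. The quantities
`e(T(n, a)) ≤ D_d(n) ≤ W_d(n) ≤ U_d(n) ≤ ex(n, K_{a+1}(t))` are squeezed together, since by the
Erdős–Stone theorem both ends are `(1 - 1/a) n² / 2 + o(n²)` for every fixed `t`.

The link with antipodality is metric: for a strictly antipodal family of finite sets with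
at least two points each there is a strictly convex norm in which points of different members are
at distance one and all points at distance at most one, namely a maximum of Euclidean norms, one
for each difference of points in different members. Conversely, supporting
functionals of the unit ball turn such a configuration into a strictly antipodal family. The
first direction, for `a` sets of size at least `n`, places `T(n, a)` in the graph of diameters.
In the other direction, each class of a copy of `K_{a+1}(t)` in a unit distance graph lies in a
unit ball, so when `t` is large it contains many points with mutual distances at most one; these
form strictly antipodal families of `a + 1` arbitrarily large sets, which do not exist.

Finally `D_d(n) ≤ W_d(n)` because two distinct diameters of a set are never parallel: they would
be opposite sides of a parallelogram whose diagonals are both no longer than these sides. -/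

section ExtremalNumbers

open SimpleGraph

theorem tendsto_choose_two_div_sq :
    Tendsto (fun n : ℕ => (n.choose 2 : ℝ) / (n : ℝ) ^ 2) atTop (𝓝 (1 / 2)) := by
  have h : Tendsto (fun n : ℕ => (1 / 2 : ℝ) * (1 - (n : ℝ)⁻¹)) atTop (𝓝 (1 / 2)) := by
    simpa using (tendsto_inv_atTop_nhds_zero_nat (𝕜 := ℝ)).const_sub 1 |>.const_mul (1 / 2 : ℝ)
  refine h.congr' ?_
  filter_upwards [eventually_ne_atTop 0] with n hn
  rw [Nat.cast_choose_two]
  field_simp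

theorem tendsto_extremalNumber_div_sq {W : Type*} (H : SimpleGraph W) :
    Tendsto (fun n : ℕ => (extremalNumber n H : ℝ) / (n : ℝ) ^ 2) atTop
      (𝓝 (1 / 2 * turanDensity H)) := by
  rw [mul_comm]
  refine ((tendsto_turanDensity H).mul tendsto_choose_two_div_sq).congr' ?_
  filter_upwards [eventually_ge_atTop 2] with n hn
  have : (n.choose 2 : ℝ) ≠ 0 := by exact_mod_cast (Nat.choose_pos hn).ne'
  rw [div_mul_div_cancel₀ this]

theorem le_half_of_tendsto_div_sq {x : ℕ → ℝ} {c L : ℝ}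
    (hx : ∀ᶠ n : ℕ in atTop, x (n + 1) ≤ x n + c * (n + 1))
    (hL : Tendsto (fun n : ℕ => x n / (n : ℝ) ^ 2) atTop (𝓝 L)) : L ≤ 1 / 2 * c := by
  obtain ⟨M, hM⟩ := eventually_atTop.1 hx
  let y : ℕ → ℝ := fun n => x n - c * (n * (n + 1) / 2)
  have hy : ∀ n ≥ M, y n ≤ y M := fun n hn => by
    induction n, hn using Nat.le_induction with
    | base => exact le_rfl
    | succ n hn ih =>
      refine le_trans ?_ ih
      have := hM n hn
      simp only [y]
      push_cast
      linarith
  have hlim : Tendsto (fun n : ℕ => y M * (n : ℝ)⁻¹ ^ 2 + c / 2 * (1 + (n : ℝ)⁻¹)) atTop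
      (𝓝 (1 / 2 * c)) := by
    have hinv := tendsto_inv_atTop_nhds_zero_nat (𝕜 := ℝ)
    convert ((hinv.pow 2).const_mul (y M)).add ((hinv.const_add 1).const_mul (c / 2)) using 2
    ring
  refine le_of_tendsto_of_tendsto hL hlim ?_
  filter_upwards [eventually_ge_atTop M, eventually_ne_atTop 0] with n hn hn0
  calc x n / (n : ℝ) ^ 2 = (y n + c * (n * (n + 1) / 2)) / (n : ℝ) ^ 2 := by simp [y]
    _ ≤ (y M + c * (n * (n + 1) / 2)) / (n : ℝ) ^ 2 := by gcongr; exact hy n hn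
    _ = y M * (n : ℝ)⁻¹ ^ 2 + c / 2 * (1 + (n : ℝ)⁻¹) := by field_simp

theorem extremalNumber_succ_le_of_minDegree {W : Type*} {H : SimpleGraph W} {n : ℕ} {δ : ℝ}
    (hδ : 0 ≤ δ)
    (h : ∀ {G : SimpleGraph (Fin (n + 1))} [DecidableRel G.Adj], δ ≤ G.minDegree → H ⊑ G) :
    (extremalNumber (n + 1) H : ℝ) ≤ extremalNumber n H + δ := by
  have key := extremalNumber_le_iff_of_nonneg (V := Fin (n + 1)) H
    (add_nonneg (extremalNumber n H).cast_nonneg hδ)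
  rw [Fintype.card_fin] at key
  refine key.2 fun G _ hG => ?_
  have hmin : (G.minDegree : ℝ) < δ := not_le.1 fun hle => hG (h hle)
  obtain ⟨v, hv⟩ := G.exists_minimal_degree_vertex
  have hdel := card_edgeFinset_deleteIncidenceSet_le_extremalNumber hG v
  rw [G.card_edgeFinset_deleteIncidenceSet v, Fintype.card_fin, Nat.add_sub_cancel, ← hv] at hdel
  have hle : (G.edgeFinset.card : ℝ) ≤ extremalNumber n H + G.minDegree := by
    exact_mod_cast Nat.sub_le_iff_le_add.1 hdel
  linarith

theorem turanDensity_completeEquipartiteGraph_le {r : ℕ} (t : ℕ) :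
    turanDensity (completeEquipartiteGraph (r + 1) t) ≤ 1 - 1 / r := by
  refine le_of_forall_pos_le_add fun ε hε => ?_
  have hstep : ∀ᶠ n : ℕ in atTop,
      (extremalNumber (n + 1) (completeEquipartiteGraph (r + 1) t) : ℝ) ≤
        extremalNumber n (completeEquipartiteGraph (r + 1) t) + (1 - 1 / r + ε) * (n + 1) := by
    have hr : (1 : ℝ) / r ≤ 1 := by simpa using Nat.cast_inv_le_one r
    filter_upwards [(tendsto_add_atTop_nat 1).eventually
      (eventually_completeEquipartiteGraph_isContained_of_minDegree hε r t)] with n hn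
    refine extremalNumber_succ_le_of_minDegree (mul_nonneg (by linarith) (by positivity)) ?_
    exact_mod_cast hn
  have := le_half_of_tendsto_div_sq hstep (tendsto_extremalNumber_div_sq _)
  linarith

theorem two_mul_card_edgeFinset_turanGraph {r : ℕ} (hr : 1 ≤ r) (n : ℕ) :
    2 * r * ((turanGraph n r).edgeFinset.card : ℝ) + (n % r : ℕ) * (r - (n % r : ℕ)) =
      (r - 1) * (n : ℝ) ^ 2 := by
  induction n using Nat.strong_induction_on with
  | _ n ih =>
    rcases lt_or_ge n r with hn | hn
    · have htop : (turanGraph n r).edgeFinset.card = n.choose 2 := by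
        simp [card_edgeFinset_turanGraph, Nat.mod_eq_of_lt hn]
      rw [htop, Nat.mod_eq_of_lt hn, Nat.cast_choose_two]
      ring
    · obtain ⟨m, rfl⟩ := Nat.exists_eq_add_of_le' hn
      have hm := ih m (by omega)
      rw [card_edgeFinset_turanGraph_add, Nat.add_mod_right]
      push_cast [Nat.cast_sub hr, Nat.cast_choose_two]
      linear_combination hm

theorem tendsto_card_edgeFinset_turanGraph_div_sq {r : ℕ} (hr : 1 ≤ r) :
    Tendsto (fun n : ℕ => ((turanGraph n r).edgeFinset.card : ℝ) / (n : ℝ) ^ 2) atTop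
      (𝓝 (1 / 2 * (1 - 1 / r))) := by
  have : (r : ℝ) ≠ 0 := by exact_mod_cast (Nat.one_le_iff_ne_zero.1 hr)
  have hrem : Tendsto (fun n : ℕ => ((n % r : ℕ) * (r - (n % r : ℕ)) : ℝ) / (n : ℝ) ^ 2) atTop
      (𝓝 0) := by
    have hbound : Tendsto (fun n : ℕ => (r : ℝ) ^ 2 / (n : ℝ) ^ 2) atTop (𝓝 0) :=
      tendsto_const_nhds.div_atTop
        ((tendsto_pow_atTop two_ne_zero).comp tendsto_natCast_atTop_atTop)
    have hmod : ∀ n : ℕ, ((n % r : ℕ) : ℝ) ≤ r := fun n => by exact_mod_cast (n.mod_lt hr).le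
    refine squeeze_zero (fun n => ?_) (fun n => ?_) hbound
    · have := sub_nonneg.2 (hmod n)
      positivity
    · gcongr
      nlinarith [hmod n, (n % r).cast_nonneg (α := ℝ)]
  have hlim := (hrem.const_sub ((r : ℝ) - 1)).div_const (2 * r)
  rw [show ((r : ℝ) - 1 - 0) / (2 * r) = 1 / 2 * (1 - 1 / r) by field_simp; ring] at hlim
  refine hlim.congr' ?_
  filter_upwards [eventually_ne_atTop 0] with n hn
  have := two_mul_card_edgeFinset_turanGraph hr n
  field_simp
  linear_combination -this

theorem completeEquipartiteGraph_free_turanGraph {r t : ℕ} (hr : 1 ≤ r) (ht : 1 ≤ t) (n : ℕ) :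
    (completeEquipartiteGraph (r + 1) t).Free (turanGraph n r) := by
  have htop : (⊤ : SimpleGraph (Fin (r + 1))) ⊑ completeEquipartiteGraph (r + 1) t :=
    ⟨⟨⟨fun i => (i, ⟨0, ht⟩), id⟩, fun _ _ h => congrArg Prod.fst h⟩⟩
  exact fun h => (not_cliqueFree_iff_top_isContained _).2 (htop.trans h) (turanGraph_cliqueFree hr)

theorem turanDensity_completeEquipartiteGraph {r t : ℕ} (hr : 1 ≤ r) (ht : 1 ≤ t) :
    turanDensity (completeEquipartiteGraph (r + 1) t) = 1 - 1 / r := by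
  refine (turanDensity_completeEquipartiteGraph_le t).antisymm ?_
  have := le_of_tendsto_of_tendsto' (tendsto_card_edgeFinset_turanGraph_div_sq hr)
    (tendsto_extremalNumber_div_sq (completeEquipartiteGraph (r + 1) t)) fun n => by
      gcongr
      simpa using card_edgeFinset_le_extremalNumber
        (completeEquipartiteGraph_free_turanGraph hr ht n)
  linarith

theorem tendsto_div_sq_of_turanGraph_le_of_le_extremalNumber {r t : ℕ} (hr : 1 ≤ r) (ht : 1 ≤ t)
    {f : ℕ → ℕ} (hlow : ∀ n, (turanGraph n r).edgeFinset.card ≤ f n)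
    (hupp : ∀ n, f n ≤ extremalNumber n (completeEquipartiteGraph (r + 1) t)) :
    Tendsto (fun n : ℕ => (f n : ℝ) / (n : ℝ) ^ 2) atTop (𝓝 (1 / 2 * (1 - 1 / r))) := by
  have hT := tendsto_card_edgeFinset_turanGraph_div_sq hr
  have hex := tendsto_extremalNumber_div_sq (completeEquipartiteGraph (r + 1) t)
  rw [turanDensity_completeEquipartiteGraph hr ht] at hex
  refine tendsto_of_tendsto_of_tendsto_of_le_of_le hT hex (fun n => ?_) fun n => ?_
  · dsimp only
    gcongr
    exact hlow n
  · dsimp only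
    gcongr
    exact hupp n

end ExtremalNumbers

section FiniteDimensional

variable {E : Type*} [AddCommGroup E] [Module ℝ E]

theorem exists_linearMap_eq_seminorm_forall_le (N : Seminorm ℝ E) (x : E) :
    ∃ φ : E →ₗ[ℝ] ℝ, φ x = N x ∧ ∀ y, φ y ≤ N y := by
  let : SeminormedAddCommGroup E := N.toAddGroupSeminorm.toSeminormedAddCommGroup
  let : NormedSpace ℝ E := ⟨fun a b => (map_smul_eq_mul N a b).le⟩
  obtain ⟨g, hg, hgx⟩ := exists_dual_vector'' ℝ x
  refine ⟨g.toLinearMap, hgx, fun y => (Real.le_norm_self _).trans ?_⟩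
  exact (g.le_of_opNorm_le hg y).trans_eq (one_mul _)

theorem card_le_five_pow_finrank_of_separated [FiniteDimensional ℝ E] {N : Seminorm ℝ E}
    (hN : ∀ x, N x = 0 → x = 0) {s : Finset E} {z : E} {r : ℝ} (hr : 0 < r)
    (hs : ∀ x ∈ s, N (x - z) ≤ 2 * r) (hsep : (s : Set E).Pairwise fun x y => r ≤ N (x - y)) :
    s.card ≤ 5 ^ Module.finrank ℝ E := by
  classical
  let : NormedAddCommGroup E := AddGroupNorm.toNormedAddCommGroup
    { N.toAddGroupSeminorm with eq_zero_of_map_eq_zero' := hN }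
  let : NormedSpace ℝ E := ⟨fun a b => (map_smul_eq_mul N a b).le⟩
  have hsmul : ∀ v : E, ‖r⁻¹ • v‖ = N v / r := fun v => by
    rw [norm_smul, norm_inv, Real.norm_of_nonneg hr.le, inv_mul_eq_div]
    rfl
  have hinj : Function.Injective fun x : E => r⁻¹ • (x - z) :=
    (smul_right_injective E (inv_ne_zero hr.ne')).comp (sub_left_injective (b := z))
  rw [← Finset.card_image_of_injective s hinj]
  refine Besicovitch.card_le_of_separated _ ?_ ?_ <;> simp only [Finset.forall_mem_image]
  · intro x hx
    rw [hsmul, div_le_iff₀ hr]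
    exact hs x hx
  · intro x hx y hy hxy
    rw [← smul_sub, sub_sub_sub_cancel_right, hsmul, one_le_div hr]
    exact hsep hx hy fun h => hxy (by rw [h])

theorem exists_subset_pairwise_forall_exists_not {α : Type*} {R : α → α → Prop}
    (hirrefl : ∀ x, ¬ R x x) (hsymm : ∀ x y, R x y → R y x) (Q : Finset α) :
    ∃ S ⊆ Q, (S : Set α).Pairwise R ∧ ∀ x ∈ Q, ∃ s ∈ S, ¬ R x s := by
  classical
  induction Q using Finset.induction_on with
  | empty => exact ⟨∅, by simp⟩
  | insert x Q _ ih =>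
    obtain ⟨S, hSQ, hS, hcover⟩ := ih
    by_cases hx : ∃ s ∈ S, ¬ R x s
    · exact ⟨S, hSQ.trans (Finset.subset_insert x Q), hS, Finset.forall_mem_insert _ _ _ |>.2
        ⟨hx, hcover⟩⟩
    · push Not at hx
      refine ⟨insert x S, Finset.insert_subset_insert x hSQ, ?_, ?_⟩
      · rw [Finset.coe_insert]
        exact hS.insert fun s hs _ => ⟨hx s hs, hsymm _ _ (hx s hs)⟩
      · refine (Finset.forall_mem_insert _ _ _).2
          ⟨⟨x, Finset.mem_insert_self x S, hirrefl x⟩, fun y hy => ?_⟩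
        obtain ⟨s, hs, hys⟩ := hcover y hy
        exact ⟨s, Finset.mem_insert_of_mem hs, hys⟩

theorem exists_subset_lt_card_forall_map_sub_le_one [FiniteDimensional ℝ E] {N : Seminorm ℝ E}
    (hN : ∀ x, N x = 0 → x = 0) {Q : Finset E} {z : E} (hQ : ∀ x ∈ Q, N (x - z) ≤ 1) {m : ℕ}
    (hm : 5 ^ Module.finrank ℝ E * m < Q.card) :
    ∃ S ⊆ Q, m < S.card ∧ ∀ x ∈ S, ∀ y ∈ S, N (x - y) ≤ 1 := by
  classical
  obtain ⟨C, hCQ, hsep, hcover⟩ := exists_subset_pairwise_forall_exists_not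
    (R := fun x y => 1 / 2 ≤ N (x - y)) (by simp) (fun x y h => map_sub_rev N x y ▸ h) Q
  have hcard : C.card ≤ 5 ^ Module.finrank ℝ E :=
    card_le_five_pow_finrank_of_separated (z := z) hN one_half_pos
      (fun x hx => by linarith [hQ x (hCQ hx)]) hsep
  choose! g hgC hg using hcover
  obtain ⟨c, -, hc⟩ := Finset.exists_lt_card_fiber_of_mul_lt_card_of_maps_to hgC
    ((Nat.mul_le_mul_right m hcard).trans_lt hm)
  have hnear : ∀ x ∈ Q.filter fun x => g x = c, N (x - c) < 1 / 2 := fun x hx => by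
    obtain ⟨hxQ, rfl⟩ := Finset.mem_filter.1 hx
    exact not_le.1 (hg x hxQ)
  refine ⟨_, Finset.filter_subset _ Q, hc, fun x hx y hy => ?_⟩
  calc N (x - y) = N ((x - c) - (y - c)) := by rw [sub_sub_sub_cancel_right]
    _ ≤ N (x - c) + N (y - c) := map_sub_le_add N _ _
    _ ≤ 1 := by linarith [hnear x hx, hnear y hy]

end FiniteDimensional

section StrictlyConvexNorms

variable {d : ℕ}

theorem isStrictlyConvexNorm_normSeminorm_comp {F : Type*} [NormedAddCommGroup F]
    [NormedSpace ℝ F] [StrictConvexSpace ℝ F] {T : Rd d →ₗ[ℝ] F} (hT : Function.Injective T) :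
    IsStrictlyConvexNorm ((normSeminorm ℝ F).comp T) where
  eq_zero_of_map_eq_zero x hx := (map_eq_zero_iff T hT).1 (norm_eq_zero.1 hx)
  map_add_lt_two x y hx hy hxy := by
    change ‖T x‖ = 1 at hx
    change ‖T y‖ = 1 at hy
    change ‖T (x + y)‖ < 2
    have h := (norm_midpoint_lt_iff (hx.trans hy.symm)).2 (hT.ne hxy)
    rw [norm_smul, hx, Real.norm_of_nonneg one_half_pos.le, ← map_add] at h
    linarith

namespace IsStrictlyConvexNorm

variable {N M : Seminorm ℝ (Rd d)}

theorem map_add_lt (hN : IsStrictlyConvexNorm N) {x y : Rd d} (hx : N x ≤ 1) (hy : N y ≤ 1)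
    (hxy : x ≠ y) : N (x + y) < 2 := by
  have hadd := map_add_le_add N x y
  rcases hx.lt_or_eq with hx | hx
  · linarith
  rcases hy.lt_or_eq with hy | hy
  · linarith
  exact hN.map_add_lt_two x y hx hy hxy

theorem sup (hN : IsStrictlyConvexNorm N) (hM : IsStrictlyConvexNorm M) :
    IsStrictlyConvexNorm (N ⊔ M) where
  eq_zero_of_map_eq_zero x hx := hN.eq_zero_of_map_eq_zero x <|
    le_antisymm ((le_sup_left : N x ≤ N x ⊔ M x).trans_eq hx) (apply_nonneg N x)
  map_add_lt_two _ _ hx hy hxy := max_lt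
    (hN.map_add_lt ((le_max_left _ _).trans_eq hx) ((le_max_left _ _).trans_eq hy) hxy)
    (hM.map_add_lt ((le_max_right _ _).trans_eq hx) ((le_max_right _ _).trans_eq hy) hxy)

theorem comp {e : ℕ} {T : Rd e →ₗ[ℝ] Rd d} (hN : IsStrictlyConvexNorm N)
    (hT : Function.Injective T) : IsStrictlyConvexNorm (N.comp T) where
  eq_zero_of_map_eq_zero x hx := (map_eq_zero_iff T hT).1 (hN.eq_zero_of_map_eq_zero _ hx)
  map_add_lt_two x y hx hy hxy := by
    rw [Seminorm.comp_apply, map_add]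
    exact hN.map_add_lt_two _ _ hx hy (hT.ne hxy)

theorem exists_forall_eq_mul (hN : IsStrictlyConvexNorm N) {c : ℝ} (hc : 0 < c) :
    ∃ M : Seminorm ℝ (Rd d), IsStrictlyConvexNorm M ∧ ∀ x, M x = c * N x := by
  refine ⟨N.comp (c • LinearMap.id), hN.comp (smul_right_injective (Rd d) hc.ne'), fun x => ?_⟩
  rw [Seminorm.comp_apply, LinearMap.smul_apply, LinearMap.id_apply, map_smul_eq_mul,
    Real.norm_of_nonneg hc.le]

theorem linearMap_lt_one (hN : IsStrictlyConvexNorm N) {φ : Rd d →ₗ[ℝ] ℝ} (hφ : ∀ y, φ y ≤ N y)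
    {x y : Rd d} (hx : N x = 1) (hφx : φ x = 1) (hy : N y ≤ 1) (hxy : x ≠ y) : φ y < 1 := by
  have hadd := (hφ (x + y)).trans_lt (hN.map_add_lt hx.le hy hxy)
  rw [map_add, hφx] at hadd
  linarith

theorem eq_and_eq_of_sub_eq_sub (hN : IsStrictlyConvexNorm N) {p q x y : Rd d}
    (hpq : N (p - q) = 1) (hpy : N (p - y) ≤ 1) (hxq : N (x - q) ≤ 1) (h : p - q = x - y) :
    p = x ∧ q = y := by
  have hsum : (p - y) + (x - q) = (2 : ℝ) • (p - q) := by
    rw [two_smul]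
    nth_rewrite 2 [h]
    abel
  -- Otherwise the midpoint `p - q` of these two diagonals would have norm less than one.
  have hdiag : p - y = x - q := by
    by_contra hne
    have hlt := hN.map_add_lt hpy hxq hne
    rw [hsum, map_smul_eq_mul, Real.norm_ofNat, hpq] at hlt
    linarith
  have hqy : q = y := by
    rw [hdiag, ← two_smul ℝ] at hsum
    exact (sub_right_injective (hdiag.trans (smul_right_injective _ two_ne_zero hsum))).symm
  exact ⟨by simpa [hqy] using h, hqy⟩

end IsStrictlyConvexNorm

theorem exists_isStrictlyConvexNorm_sq_eq (ψ : Rd d →ₗ[ℝ] ℝ) (v : Rd d) {c : ℝ} (hc : 0 < c) :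
    ∃ N : Seminorm ℝ (Rd d), IsStrictlyConvexNorm N ∧
      ∀ x, N x ^ 2 = ψ x ^ 2 + c * ‖x - ψ x • v‖ ^ 2 := by
  let T : Rd d →ₗ[ℝ] WithLp 2 (ℝ × Rd d) :=
    (WithLp.linearEquiv 2 ℝ (ℝ × Rd d)).symm.toLinearMap ∘ₗ
      ψ.prod (√c • (LinearMap.id - ψ.smulRight v))
  have hT : ∀ x, ‖T x‖ ^ 2 = ψ x ^ 2 + c * ‖x - ψ x • v‖ ^ 2 := fun x => by
    rw [WithLp.prod_norm_sq_eq_of_L2]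
    change ‖ψ x‖ ^ 2 + ‖√c • (x - ψ x • v)‖ ^ 2 = _
    simp only [norm_smul, mul_pow, Real.norm_eq_abs, sq_abs, Real.sq_sqrt hc.le]
  refine ⟨_, isStrictlyConvexNorm_normSeminorm_comp (T := T) ?_, hT⟩
  refine (injective_iff_map_eq_zero T).2 fun x hx => ?_
  have hsum := hT x
  rw [hx, norm_zero, zero_pow two_ne_zero, eq_comm,
    add_eq_zero_iff_of_nonneg (sq_nonneg _) (by positivity)] at hsum
  have hψ : ψ x = 0 := pow_eq_zero_iff two_ne_zero |>.1 hsum.1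
  simpa [hψ, hc.ne'] using hsum.2

theorem exists_isStrictlyConvexNorm_of_abs_lt_one {V : Set (Rd d)} (hV : V.Finite) {v : Rd d}
    {ψ : Rd d →ₗ[ℝ] ℝ} (hv : ψ v = 1) (hψ : ∀ w ∈ V, w ≠ v → w ≠ -v → |ψ w| < 1) :
    ∃ N : Seminorm ℝ (Rd d), IsStrictlyConvexNorm N ∧ N v = 1 ∧ ∀ w ∈ V, N w ≤ 1 := by
  have hsmall : ∀ w ∈ V, ∀ᶠ c : ℝ in 𝓝[>] 0, ψ w ^ 2 + c * ‖w - ψ w • v‖ ^ 2 ≤ 1 := by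
    intro w hw
    rcases eq_or_ne w v with rfl | hwv
    · simp [hv]
    rcases eq_or_ne w (-v) with rfl | hwv'
    · simp [hv]
    have hlim : Tendsto (fun c : ℝ => ψ w ^ 2 + c * ‖w - ψ w • v‖ ^ 2) (𝓝[>] 0)
        (𝓝 (ψ w ^ 2)) :=
      (Continuous.tendsto' (by fun_prop) _ _ (by simp)).mono_left nhdsWithin_le_nhds
    exact (hlim.eventually_lt_const
      ((sq_lt_one_iff_abs_lt_one _).2 (hψ w hw hwv hwv'))).mono fun _ => le_of_lt
  obtain ⟨c, hcV, hc⟩ :=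
    (((Filter.eventually_all_finite hV).2 hsmall).and self_mem_nhdsWithin).exists
  obtain ⟨N, hN, hNsq⟩ := exists_isStrictlyConvexNorm_sq_eq ψ v hc
  refine ⟨N, hN, ?_, fun w hw => ?_⟩
  · rw [← pow_eq_one_iff_of_nonneg (apply_nonneg N v) two_ne_zero, hNsq]
    simp [hv]
  · rw [← sq_le_one_iff₀ (apply_nonneg N w), hNsq]
    exact hcV w hw

theorem exists_isStrictlyConvexNorm_forall_le_one {V : Set (Rd d)} (hV : V.Finite) :
    ∃ N : Seminorm ℝ (Rd d), IsStrictlyConvexNorm N ∧ ∀ w ∈ V, N w ≤ 1 := by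
  obtain ⟨B, hB, hVB⟩ := hV.isBounded.exists_pos_norm_le
  obtain ⟨N, hN, hNeq⟩ :=
    (isStrictlyConvexNorm_normSeminorm d).exists_forall_eq_mul (inv_pos.2 hB)
  refine ⟨N, hN, fun w hw => ?_⟩
  rw [hNeq, inv_mul_le_one₀ hB]
  exact hVB w hw

theorem exists_isStrictlyConvexNorm_eq_one {V S : Set (Rd d)} (hV : V.Finite) (hSV : S ⊆ V)
    (hS : ∀ v ∈ S, ∃ N : Seminorm ℝ (Rd d),
      IsStrictlyConvexNorm N ∧ N v = 1 ∧ ∀ w ∈ V, N w ≤ 1) :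
    ∃ N : Seminorm ℝ (Rd d), IsStrictlyConvexNorm N ∧ (∀ v ∈ S, N v = 1) ∧
      ∀ w ∈ V, N w ≤ 1 := by
  induction S, hV.subset hSV using Set.Finite.induction_on with
  | empty => simpa using exists_isStrictlyConvexNorm_forall_le_one hV
  | @insert v S _ _ ih =>
    rw [Set.insert_subset_iff] at hSV
    rw [Set.forall_mem_insert] at hS
    obtain ⟨N, hN, hN1, hNV⟩ := ih hSV.2 hS.2
    obtain ⟨M, hM, hM1, hMV⟩ := hS.1
    refine ⟨N ⊔ M, hN.sup hM, Set.forall_mem_insert.2 ⟨?_, fun w hw => ?_⟩, fun w hw =>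
      max_le (hNV w hw) (hMV w hw)⟩
    · exact (max_eq_right ((hNV v hSV.1).trans_eq hM1.symm)).trans hM1
    · exact (max_eq_left ((hMV w (hSV.2 hw)).trans_eq (hN1 w hw).symm)).trans (hN1 w hw)

end StrictlyConvexNorms

section AntipodalFamilies

section Seminorms

variable {E ι : Type*} [AddCommGroup E] [Module ℝ E]

/-- A family of sets is *unit antipodal* for a seminorm `N` if its union has `N`-diameter at most
one and any two points in members with different indices are at distance exactly one. For
strictly convex norms this is the metric counterpart of strict antipodality. -/
structure IsUnitAntipodal (N : Seminorm ℝ E) (A : ι → Set E) : Prop where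
  map_sub_eq_one : ∀ ⦃i j⦄, i ≠ j → ∀ p ∈ A i, ∀ q ∈ A j, N (p - q) = 1
  map_sub_le_one : ∀ i j, ∀ p ∈ A i, ∀ q ∈ A j, N (p - q) ≤ 1

namespace IsUnitAntipodal

variable {N : Seminorm ℝ E} {A : ι → Set E}

theorem ne (hA : IsUnitAntipodal N A) {i j : ι} (hij : i ≠ j) {p q : E} (hp : p ∈ A i)
    (hq : q ∈ A j) : p ≠ q := by
  rintro rfl
  simpa using hA.map_sub_eq_one hij p hp p hq

theorem card_le [Fintype ι] [FiniteDimensional ℝ E] (hA : IsUnitAntipodal N A)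
    (hN : ∀ x, N x = 0 → x = 0) (hne : ∀ i, (A i).Nonempty) :
    Fintype.card ι ≤ 5 ^ Module.finrank ℝ E := by
  classical
  choose p hp using hne
  rcases isEmpty_or_nonempty ι with h | ⟨⟨i₀⟩⟩
  · simp
  have hinj : Function.Injective p := fun i j hij => by
    by_contra h
    exact hA.ne h (hp i) (hp j) hij
  rw [← Finset.card_univ, ← Finset.card_image_of_injective _ hinj]
  refine card_le_five_pow_finrank_of_separated (z := p i₀) hN one_pos ?_ ?_
  · simp only [Finset.forall_mem_image]
    intro i _
    linarith [hA.map_sub_le_one i i₀ _ (hp i) _ (hp i₀)]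
  · rw [Finset.coe_image, Finset.coe_univ, Set.image_univ]
    rintro _ ⟨i, rfl⟩ _ ⟨j, rfl⟩ hij
    exact (hA.map_sub_eq_one (fun h => hij (congrArg p h)) _ (hp i) _ (hp j)).ge

end IsUnitAntipodal

end Seminorms

variable {d : ℕ}

theorem IsUnitAntipodal.strictlyAntipodal {ι : Type*} {N : Seminorm ℝ (Rd d)} {A : ι → Set (Rd d)}
    (hA : IsUnitAntipodal N A) (hN : IsStrictlyConvexNorm N) : StrictlyAntipodal A := by
  intro i j hij p hp q hq
  have hqp : N (q - p) = 1 := hA.map_sub_eq_one hij.symm q hq p hp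
  obtain ⟨φ, hφ, hφN⟩ := exists_linearMap_eq_seminorm_forall_le N (q - p)
  rw [hqp] at hφ
  refine ⟨φ, ?_⟩
  rintro r ⟨hr, hrpq⟩
  obtain ⟨l, hl⟩ := Set.mem_iUnion.1 hr
  rw [Set.mem_insert_iff, Set.mem_singleton_iff, not_or] at hrpq
  have hqr : φ (q - r) < 1 := hN.linearMap_lt_one hφN hqp hφ (hA.map_sub_le_one j l q hq r hl)
    fun h => hrpq.1 (sub_right_injective h).symm
  have hrp : φ (r - p) < 1 := hN.linearMap_lt_one hφN hqp hφ (hA.map_sub_le_one l i r hl p hp)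
    fun h => hrpq.2 (sub_left_injective h).symm
  rw [map_sub] at hφ hqr hrp
  constructor <;> linarith

namespace StrictlyAntipodal

variable {ι : Type*} {A B : ι → Set (Rd d)}

theorem mono (hB : StrictlyAntipodal B) (hAB : ∀ i, A i ⊆ B i) : StrictlyAntipodal A := by
  intro i j hij p hp q hq
  obtain ⟨φ, hφ⟩ := hB i j hij p (hAB i hp) q (hAB j hq)
  exact ⟨φ, fun r hr => hφ r (Set.sdiff_subset_sdiff_left (Set.iUnion_mono hAB) hr)⟩

theorem disjoint (hA : StrictlyAntipodal A) {i j : ι} (hij : i ≠ j) (hi : (A i).Nontrivial) :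
    Disjoint (A i) (A j) := by
  refine Set.disjoint_left.2 fun p hpi hpj => ?_
  obtain ⟨φ, hφ⟩ := hA i j hij p hpi p hpj
  obtain ⟨r, hr, hrp⟩ := hi.exists_ne p
  exact lt_asymm (hφ r ⟨Set.mem_iUnion.2 ⟨i, hr⟩, by simpa using hrp⟩).1
    (hφ r ⟨Set.mem_iUnion.2 ⟨i, hr⟩, by simpa using hrp⟩).2

theorem exists_linearMap_lt (hA : StrictlyAntipodal A) {i j : ι} (hij : i ≠ j)
    (hi : (A i).Nontrivial) {p q : Rd d} (hp : p ∈ A i) (hq : q ∈ A j) :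
    ∃ φ : Rd d →ₗ[ℝ] ℝ, φ q < φ p ∧
      ∀ r ∈ ⋃ l, A l, r = p ∨ r = q ∨ φ q < φ r ∧ φ r < φ p := by
  obtain ⟨φ, hφ⟩ := hA j i hij.symm q hq p hp
  obtain ⟨r, hr, hrp⟩ := hi.exists_ne p
  have hrq : r ≠ q := (hA.disjoint hij hi).ne_of_mem hr hq
  have hφr := hφ r ⟨Set.mem_iUnion.2 ⟨i, hr⟩, by simp [hrp, hrq]⟩
  refine ⟨φ, hφr.1.trans hφr.2, fun x hx => ?_⟩
  rw [← or_assoc]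
  exact or_iff_not_imp_left.2 fun hne => hφ x ⟨hx, by simpa [or_comm] using hne⟩

theorem exists_linearMap_abs_lt_one (hA : StrictlyAntipodal A) {i j : ι} (hij : i ≠ j)
    (hi : (A i).Nontrivial) {p q : Rd d} (hp : p ∈ A i) (hq : q ∈ A j) :
    ∃ ψ : Rd d →ₗ[ℝ] ℝ, ψ (p - q) = 1 ∧
      ∀ x ∈ ⋃ l, A l, ∀ y ∈ ⋃ l, A l, s(x, y) ≠ s(p, q) → |ψ (x - y)| < 1 := by
  obtain ⟨φ, hφ, hφA⟩ := hA.exists_linearMap_lt hij hi hp hq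
  have hpos : 0 < φ p - φ q := sub_pos.2 hφ
  refine ⟨(φ p - φ q)⁻¹ • φ, ?_, fun x hx y hy hxy => ?_⟩
  · rw [LinearMap.smul_apply, map_sub, smul_eq_mul, inv_mul_cancel₀ hpos.ne']
  · rw [LinearMap.smul_apply, map_sub, smul_eq_mul, abs_mul, abs_of_pos (inv_pos.2 hpos),
      inv_mul_lt_iff₀ hpos, mul_one, abs_sub_lt_iff]
    rw [ne_eq, Sym2.eq_iff] at hxy
    rcases hφA x hx with rfl | rfl | hx' <;> rcases hφA y hy with rfl | rfl | hy' <;>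
      first | (constructor <;> linarith) | (exfalso; tauto)

theorem exists_isUnitAntipodal (hA : StrictlyAntipodal A) (hfin : (⋃ i, A i).Finite)
    (hnt : ∀ i, (A i).Nontrivial) :
    ∃ N : Seminorm ℝ (Rd d), IsStrictlyConvexNorm N ∧ IsUnitAntipodal N A := by
  let V : Set (Rd d) := Set.image2 (· - ·) (⋃ i, A i) (⋃ i, A i)
  let S : Set (Rd d) := {v | ∃ i j, i ≠ j ∧ ∃ p ∈ A i, ∃ q ∈ A j, p - q = v}
  have hVmem : ∀ i j, ∀ p ∈ A i, ∀ q ∈ A j, p - q ∈ V := fun i j p hp q hq =>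
    ⟨p, Set.mem_iUnion.2 ⟨i, hp⟩, q, Set.mem_iUnion.2 ⟨j, hq⟩, rfl⟩
  have hSV : S ⊆ V := by
    rintro _ ⟨i, j, -, p, hp, q, hq, rfl⟩
    exact hVmem i j p hp q hq
  have hVfin : V.Finite := hfin.image2 _ hfin
  obtain ⟨N, hN, hNS, hNV⟩ := exists_isStrictlyConvexNorm_eq_one hVfin hSV <| by
    rintro _ ⟨i, j, hij, p, hp, q, hq, rfl⟩
    obtain ⟨ψ, hψ, hψA⟩ := hA.exists_linearMap_abs_lt_one hij (hnt i) hp hq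
    refine exists_isStrictlyConvexNorm_of_abs_lt_one hVfin hψ ?_
    rintro _ ⟨x, hx, y, hy, rfl⟩ hne hne'
    refine hψA x hx y hy fun h => ?_
    rcases Sym2.eq_iff.1 h with ⟨rfl, rfl⟩ | ⟨rfl, rfl⟩
    · exact hne rfl
    · exact hne' (neg_sub _ _).symm
  exact ⟨N, hN, fun i j hij p hp q hq => hNS _ ⟨i, j, hij, p, hp, q, hq, rfl⟩,
    fun i j p hp q hq => hNV _ (hVmem i j p hp q hq)⟩

end StrictlyAntipodal

theorem mem_antipodalSizes_iff {k : ℕ} :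
    k ∈ antipodalSizes d ↔ ∀ m : ℕ, ∃ N : Seminorm ℝ (Rd d), IsStrictlyConvexNorm N ∧
      ∃ A : Fin k → Finset (Rd d), (∀ i, m ≤ (A i).card) ∧
        IsUnitAntipodal N fun i => (A i : Set (Rd d)) := by
  refine ⟨fun hk m => ?_, fun h m => ?_⟩
  · obtain ⟨B, hB, hcard⟩ := hk (m + 2)
    choose A hAB hAcard using fun i => Set.exists_subset_encard_eq (hcard i)
    have hfin : ∀ i, (A i).Finite := fun i => Set.finite_of_encard_eq_coe (hAcard i)
    obtain ⟨N, hN, hNA⟩ := (hB.mono hAB).exists_isUnitAntipodal (Set.finite_iUnion hfin)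
      fun i => Set.one_lt_encard_iff_nontrivial.1 (by rw [hAcard i]; norm_cast; omega)
    refine ⟨N, hN, fun i => (hfin i).toFinset, fun i => ?_, by simpa using hNA⟩
    have hle : ((m + 2 : ℕ) : ℕ∞) ≤ (hfin i).toFinset.card :=
      ((hfin i).encard_eq_coe_toFinset_card ▸ hAcard i).ge
    exact (Nat.le_add_right m 2).trans (by exact_mod_cast hle)
  · obtain ⟨N, hN, A, hcard, hA⟩ := h m
    refine ⟨_, hA.strictlyAntipodal hN, fun i => ?_⟩
    rw [Set.encard_coe_eq_coe_finsetCard]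
    exact_mod_cast hcard i

theorem le_of_mem_antipodalSizes {k : ℕ} (hk : k ∈ antipodalSizes d) : k ≤ 5 ^ d := by
  obtain ⟨N, hN, A, hcard, hA⟩ := mem_antipodalSizes_iff.1 hk 1
  simpa using hA.card_le hN.eq_zero_of_map_eq_zero fun i => Finset.card_pos.1 (hcard i)

theorem one_mem_antipodalSizes (hd : 1 ≤ d) : 1 ∈ antipodalSizes d := by
  have : Nonempty (Fin d) := ⟨⟨0, hd⟩⟩
  refine fun m => ⟨fun _ => Set.univ, fun i j hij => absurd (Subsingleton.elim i j) hij, ?_⟩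
  simp

theorem isGreatest_antipodalNumber (hd : 1 ≤ d) :
    IsGreatest (antipodalSizes d) (antipodalNumber d) :=
  have hbdd : BddAbove (antipodalSizes d) := ⟨5 ^ d, fun _ => le_of_mem_antipodalSizes⟩
  ⟨Nat.sSup_mem ⟨1, one_mem_antipodalSizes hd⟩ hbdd, fun _ => le_csSup hbdd⟩

end AntipodalFamilies

section UnitDistanceGraphs

open SimpleGraph

section Seminorms

variable {E : Type*} [AddCommGroup E] [Module ℝ E]

/-- The unit distance graph of a seminorm `N` on the whole space; the unit distance graph of a
point configuration `f` is its pullback `(unitDistanceGraph N).comap f`. -/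
def unitDistanceGraph (N : Seminorm ℝ E) : SimpleGraph E where
  Adj p q := N (p - q) = 1
  symm := ⟨fun p q h => by rwa [map_sub_rev]⟩
  loopless := ⟨fun p h => by simp at h⟩

theorem IsUnitAntipodal.exists_turanGraph_le_comap {N : Seminorm ℝ E} {k n : ℕ} (hk : 1 ≤ k)
    {A : Fin k → Finset E} (hA : IsUnitAntipodal N fun i => (A i : Set E))
    (hcard : ∀ i, n ≤ (A i).card) :
    ∃ f : Fin n ↪ E, (∀ x, ∃ i, f x ∈ A i) ∧ turanGraph n k ≤ (unitDistanceGraph N).comap f := by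
  have g : ∀ i, Fin n ↪ A i := fun i =>
    (Function.Embedding.nonempty_of_card_le (by simpa using hcard i)).some
  let c : Fin n → Fin k := fun x => ⟨x % k, Nat.mod_lt _ hk⟩
  let f : Fin n → E := fun x => g (c x) x
  have hfA : ∀ x, f x ∈ A (c x) := fun x => (g (c x) x).2
  have hf : Function.Injective f := fun x y hxy => by
    by_cases h : c x = c y
    · refine (g (c x)).injective (Subtype.ext ?_)
      exact hxy.trans (by simp only [f]; rw [h])
    · exact absurd hxy (hA.ne h (hfA x) (hfA y))
  exact ⟨⟨f, hf⟩, fun x => ⟨c x, hfA x⟩, fun x y hxy =>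
    hA.map_sub_eq_one (fun h => hxy (congrArg Fin.val h)) _ (hfA x) _ (hfA y)⟩

theorem exists_isUnitAntipodal_of_completeEquipartiteGraph_isContained [FiniteDimensional ℝ E]
    {N : Seminorm ℝ E} (hN : ∀ x, N x = 0 → x = 0) {k m : ℕ} (hk : 2 ≤ k)
    (h : completeEquipartiteGraph k (5 ^ Module.finrank ℝ E * m + 1) ⊑ unitDistanceGraph N) :
    ∃ A : Fin k → Finset E, (∀ i, m ≤ (A i).card) ∧
      IsUnitAntipodal N fun i => (A i : Set E) := by
  classical
  obtain ⟨f⟩ := h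
  let Q : Fin k → Finset E := fun i => Finset.univ.image fun j => f (i, j)
  have hQcard : ∀ i, (Q i).card = 5 ^ Module.finrank ℝ E * m + 1 := fun i =>
    (Finset.card_image_of_injective _ fun j j' hj => (Prod.mk.inj (f.injective hj)).2).trans
      (by simp)
  have hQ : ∀ i i', i ≠ i' → ∀ p ∈ Q i, ∀ q ∈ Q i', N (p - q) = 1 := by
    intro i i' hi
    simp only [Q, Finset.forall_mem_image]
    exact fun j _ j' _ => f.toHom.map_adj (v := (i, j)) (w := (i', j')) hi
  have : Nontrivial (Fin k) := Fin.nontrivial_iff_two_le.2 hk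
  have hS : ∀ i, ∃ S ⊆ Q i, m < S.card ∧ ∀ x ∈ S, ∀ y ∈ S, N (x - y) ≤ 1 := fun i => by
    obtain ⟨i', hi'⟩ := exists_ne i
    obtain ⟨z, hz⟩ := Finset.card_pos.1 (by rw [hQcard i']; exact Nat.succ_pos _)
    exact exists_subset_lt_card_forall_map_sub_le_one hN
      (fun x hx => (hQ i i' hi'.symm x hx z hz).le) (by rw [hQcard i]; exact Nat.lt_succ_self _)
  choose A hAQ hAm hA using hS
  have hcross : ∀ ⦃i i'⦄, i ≠ i' → ∀ p ∈ A i, ∀ q ∈ A i', N (p - q) = 1 :=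
    fun i i' hi p hp q hq => hQ i i' hi p (hAQ i hp) q (hAQ i' hq)
  refine ⟨A, fun i => (hAm i).le, hcross, fun i i' p hp q hq => ?_⟩
  rcases eq_or_ne i i' with rfl | hi
  · exact hA i p hp q hq
  · exact (hcross hi p hp q hq).le

end Seminorms

variable {d : ℕ}

theorem card_unitPairs_map {V : Type*} [Fintype V] (N : Seminorm ℝ (Rd d)) (f : V ↪ Rd d)
    [DecidableRel ((unitDistanceGraph N).comap f).Adj] :
    (unitPairs N (Finset.univ.map f)).card = ((unitDistanceGraph N).comap f).edgeFinset.card := by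
  rw [unitPairs, Finset.sym2_map, Finset.filter_map, Finset.card_map]
  congr 1
  ext e
  induction e using Sym2.ind with
  | _ x y =>
    simp only [Finset.mem_filter, Finset.mk_mem_sym2_iff, Finset.mem_univ, and_self, true_and,
      mem_edgeFinset, mem_edgeSet]
    exact Iff.rfl

theorem card_unitPairs_le_extremalNumber {W : Type*} {H : SimpleGraph W} {N : Seminorm ℝ (Rd d)}
    (hN : H.Free (unitDistanceGraph N)) (P : Finset (Rd d)) :
    (unitPairs N P).card ≤ extremalNumber P.card H := by
  classical
  let f : P ↪ Rd d := Function.Embedding.subtype _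
  have hcomap : (unitDistanceGraph N).comap f ⊑ unitDistanceGraph N :=
    ⟨(Embedding.comap f _).toCopy⟩
  calc (unitPairs N P).card = (unitPairs N (Finset.univ.map f)).card := by
        rw [Finset.univ_eq_attach, Finset.attach_map_val]
    _ = ((unitDistanceGraph N).comap f).edgeFinset.card := card_unitPairs_map N f
    _ ≤ extremalNumber P.card H := by
        simpa using card_edgeFinset_le_extremalNumber fun h => hN (h.trans hcomap)

end UnitDistanceGraphs

section Maxima

open SimpleGraph

variable {d : ℕ}

theorem unitPairs_subset_diameterPairs {N : Seminorm ℝ (Rd d)} {P : Finset (Rd d)}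
    (hP : ∀ p ∈ P, ∀ q ∈ P, N (p - q) ≤ 1) : unitPairs N P ⊆ diameterPairs N P := by
  intro e he
  obtain ⟨heP, he1⟩ := Finset.mem_filter.1 he
  have hdiam : normDiam N P = 1 := by
    refine IsGreatest.csSup_eq ⟨⟨e, heP, he1⟩, ?_⟩
    rintro _ ⟨⟨x, y⟩, hxy, rfl⟩
    obtain ⟨hx, hy⟩ := Finset.mk_mem_sym2_iff.1 (Finset.mem_coe.1 hxy)
    exact hP x hx y hy
  refine Finset.mem_filter.2 ⟨heP, ?_, he1.trans hdiam.symm⟩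
  induction e using Sym2.ind with
  | _ x y =>
    intro hxy
    obtain rfl := Sym2.mk_isDiag_iff.1 hxy
    exact (unitDistanceGraph N).loopless.irrefl x he1

theorem map_sub_le_normDiam (N : Seminorm ℝ (Rd d)) {P : Finset (Rd d)} {p q : Rd d} (hp : p ∈ P)
    (hq : q ∈ P) : N (p - q) ≤ normDiam N P :=
  le_csSup (P.sym2.finite_toSet.image _).bddAbove
    ⟨s(p, q), Finset.mem_coe.2 (Finset.mk_mem_sym2_iff.2 ⟨hp, hq⟩), rfl⟩

theorem exists_diameterPairs_subset_unitPairs {N : Seminorm ℝ (Rd d)}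
    (hN : IsStrictlyConvexNorm N) {P : Finset (Rd d)} (hP : (diameterPairs N P).Nonempty) :
    ∃ M : Seminorm ℝ (Rd d), IsStrictlyConvexNorm M ∧ (∀ p ∈ P, ∀ q ∈ P, M (p - q) ≤ 1) ∧
      diameterPairs N P ⊆ unitPairs M P := by
  have hpos : 0 < normDiam N P := by
    obtain ⟨⟨x, y⟩, he⟩ := hP
    obtain ⟨-, hdiag, hlen⟩ := Finset.mem_filter.1 he
    refine hlen ▸ (apply_nonneg N (x - y)).lt_of_ne' fun h0 => hdiag ?_
    exact Sym2.mk_isDiag_iff.2 (sub_eq_zero.1 (hN.eq_zero_of_map_eq_zero _ h0))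
  obtain ⟨M, hM, hMN⟩ := hN.exists_forall_eq_mul (inv_pos.2 hpos)
  refine ⟨M, hM, fun p hp q hq => ?_, ?_⟩
  · rw [hMN, inv_mul_le_one₀ hpos]
    exact map_sub_le_normDiam N hp hq
  · rintro ⟨x, y⟩ he
    obtain ⟨heP, -, hlen⟩ := Finset.mem_filter.1 he
    refine Finset.mem_filter.2 ⟨heP, (hMN (x - y)).trans ?_⟩
    rw [show N (x - y) = normDiam N P from hlen, inv_mul_cancel₀ hpos.ne']

theorem pairwise_pairDirection_ne_unitPairs {N : Seminorm ℝ (Rd d)} (hN : IsStrictlyConvexNorm N)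
    {P : Finset (Rd d)} (hP : ∀ p ∈ P, ∀ q ∈ P, N (p - q) ≤ 1) :
    (unitPairs N P : Set (Sym2 (Rd d))).Pairwise
      fun e f => pairDirection e ≠ pairDirection f := by
  rintro ⟨p, q⟩ he ⟨x, y⟩ hf hne hdir
  obtain ⟨hpq, hpq1⟩ := Finset.mem_filter.1 (Finset.mem_coe.1 he)
  obtain ⟨hxy, hxy1⟩ := Finset.mem_filter.1 (Finset.mem_coe.1 hf)
  obtain ⟨hp, hq⟩ := Finset.mk_mem_sym2_iff.1 hpq
  obtain ⟨hx, hy⟩ := Finset.mk_mem_sym2_iff.1 hxy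
  change N (p - q) = 1 at hpq1
  change N (x - y) = 1 at hxy1
  obtain ⟨c, hc⟩ := Submodule.span_singleton_eq_span_singleton.1
    (show Submodule.span ℝ {p - q} = Submodule.span ℝ {x - y} from hdir)
  have hc1 : |(c : ℝ)| = 1 := by
    rwa [← hc, Units.smul_def, map_smul_eq_mul, hpq1, mul_one, Real.norm_eq_abs] at hxy1
  rw [Units.smul_def] at hc
  rcases eq_or_eq_neg_of_abs_eq hc1 with h1 | h1 <;> rw [h1] at hc
  · rw [one_smul] at hc
    obtain ⟨rfl, rfl⟩ := hN.eq_and_eq_of_sub_eq_sub hpq1 (hP p hp y hy) (hP x hx q hq) hc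
    exact hne rfl
  · rw [neg_one_smul, neg_sub] at hc
    obtain ⟨rfl, rfl⟩ := hN.eq_and_eq_of_sub_eq_sub ((map_sub_rev N q p).trans hpq1)
      (hP q hq y hy) (hP x hx p hp) hc
    exact hne Sym2.eq_swap

theorem card_edgeFinset_turanGraph_le_maxDiameterPairs (hd : 1 ≤ d) {k : ℕ} (hk : 1 ≤ k)
    (hkd : k ∈ antipodalSizes d) (n : ℕ) :
    (turanGraph n k).edgeFinset.card ≤ maxDiameterPairs d n := by
  classical
  obtain ⟨N, hN, A, hcard, hA⟩ := mem_antipodalSizes_iff.1 hkd n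
  obtain ⟨f, hfA, hf⟩ := hA.exists_turanGraph_le_comap hk hcard
  have hdiam : ∀ p ∈ Finset.univ.map f, ∀ q ∈ Finset.univ.map f, N (p - q) ≤ 1 := by
    simp only [Finset.forall_mem_map]
    intro x _ y _
    obtain ⟨i, hi⟩ := hfA x
    obtain ⟨j, hj⟩ := hfA y
    exact hA.map_sub_le_one i j _ hi _ hj
  calc (turanGraph n k).edgeFinset.card
      ≤ ((unitDistanceGraph N).comap f).edgeFinset.card := Finset.card_le_card (edgeFinset_mono hf)
    _ = (unitPairs N (Finset.univ.map f)).card := (card_unitPairs_map N f).symm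
    _ ≤ (diameterPairs N (Finset.univ.map f)).card :=
        Finset.card_le_card (unitPairs_subset_diameterPairs hdiam)
    _ ≤ maxDiameterPairs d n :=
        (isGreatest_maxDiameterPairs hd n).2 ⟨N, hN, _, by simp, rfl⟩

theorem maxDiameterPairs_le_maxNonparallelUnitPairs (hd : 1 ≤ d) (n : ℕ) :
    maxDiameterPairs d n ≤ maxNonparallelUnitPairs d n := by
  obtain ⟨N, hN, P, hP, hcard⟩ := (isGreatest_maxDiameterPairs hd n).1
  rw [← hcard]
  rcases (diameterPairs N P).eq_empty_or_nonempty with hempty | hne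
  · simp [hempty]
  · obtain ⟨M, hM, hM1, hsub⟩ := exists_diameterPairs_subset_unitPairs hN hne
    exact (isGreatest_maxNonparallelUnitPairs hd n).2 ⟨M, hM, P, hP, _, hsub,
      (pairwise_pairDirection_ne_unitPairs hM hM1).mono hsub, rfl⟩

theorem maxNonparallelUnitPairs_le_maxUnitPairs (hd : 1 ≤ d) (n : ℕ) :
    maxNonparallelUnitPairs d n ≤ maxUnitPairs d n := by
  obtain ⟨N, hN, P, hP, F, hF, -, hcard⟩ := (isGreatest_maxNonparallelUnitPairs hd n).1
  rw [← hcard]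
  exact (Finset.card_le_card hF).trans ((isGreatest_maxUnitPairs hd n).2 ⟨N, hN, P, hP, rfl⟩)

theorem exists_maxUnitPairs_le_extremalNumber (hd : 1 ≤ d) {k : ℕ} (hk : 2 ≤ k)
    (hkd : k ∉ antipodalSizes d) :
    ∃ t : ℕ, 1 ≤ t ∧ ∀ n, maxUnitPairs d n ≤ extremalNumber n (completeEquipartiteGraph k t) := by
  rw [mem_antipodalSizes_iff] at hkd
  push Not at hkd
  obtain ⟨m, hm⟩ := hkd
  refine ⟨5 ^ Module.finrank ℝ (Rd d) * m + 1, Nat.succ_pos _, fun n => ?_⟩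
  obtain ⟨N, hN, P, hP, hcard⟩ := (isGreatest_maxUnitPairs hd n).1
  rw [← hcard, ← hP]
  refine card_unitPairs_le_extremalNumber (fun h => ?_) P
  obtain ⟨A, hAm, hA⟩ := exists_isUnitAntipodal_of_completeEquipartiteGraph_isContained
    hN.eq_zero_of_map_eq_zero hk h
  exact hm N hN A hAm hA

end Maxima

theorem theorem3_general (d : ℕ) (hd : 1 ≤ d) :
    IsGreatest (antipodalSizes d) (antipodalNumber d) ∧
    Tendsto (fun n : ℕ => (maxNonparallelUnitPairs d n : ℝ) / (n : ℝ) ^ 2) atTop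
      (𝓝 ((1 / 2 : ℝ) * (1 - 1 / (antipodalNumber d : ℝ)))) ∧
    Tendsto (fun n : ℕ => (maxUnitPairs d n : ℝ) / (n : ℝ) ^ 2) atTop
      (𝓝 ((1 / 2 : ℝ) * (1 - 1 / (antipodalNumber d : ℝ)))) ∧
    Tendsto (fun n : ℕ => (maxDiameterPairs d n : ℝ) / (n : ℝ) ^ 2) atTop
      (𝓝 ((1 / 2 : ℝ) * (1 - 1 / (antipodalNumber d : ℝ)))) := by
  have ha := isGreatest_antipodalNumber hd
  have ha1 : 1 ≤ antipodalNumber d := ha.2 (one_mem_antipodalSizes hd)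
  have hsucc : antipodalNumber d + 1 ∉ antipodalSizes d := fun h => absurd (ha.2 h) (by omega)
  obtain ⟨t, ht, hU⟩ := exists_maxUnitPairs_le_extremalNumber hd (by omega) hsucc
  have hD := card_edgeFinset_turanGraph_le_maxDiameterPairs hd ha1 ha.1
  have hDW := maxDiameterPairs_le_maxNonparallelUnitPairs hd
  have hWU := maxNonparallelUnitPairs_le_maxUnitPairs hd
  have hlim : ∀ f : ℕ → ℕ, (∀ n, maxDiameterPairs d n ≤ f n) → (∀ n, f n ≤ maxUnitPairs d n) →
      Tendsto (fun n : ℕ => (f n : ℝ) / (n : ℝ) ^ 2) atTop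
        (𝓝 ((1 / 2 : ℝ) * (1 - 1 / (antipodalNumber d : ℝ)))) := fun f hDf hfU =>
    tendsto_div_sq_of_turanGraph_le_of_le_extremalNumber ha1 ht (fun n => (hD n).trans (hDf n))
      fun n => (hfU n).trans (hU n)
  exact ⟨ha, hlim _ hDW hWU, hlim _ (fun n => (hDW n).trans (hWU n)) fun _ => le_rfl,
    hlim _ (fun _ => le_rfl) fun n => (hDW n).trans (hWU n)⟩

theorem theorem3 (d : ℕ) (hd : 3 ≤ d) :
    IsGreatest (antipodalSizes d) (antipodalNumber d) ∧
    Tendsto (fun n : ℕ => (maxNonparallelUnitPairs d n : ℝ) / (n : ℝ) ^ 2) atTop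
      (𝓝 ((1 / 2 : ℝ) * (1 - 1 / (antipodalNumber d : ℝ)))) ∧
    Tendsto (fun n : ℕ => (maxUnitPairs d n : ℝ) / (n : ℝ) ^ 2) atTop
      (𝓝 ((1 / 2 : ℝ) * (1 - 1 / (antipodalNumber d : ℝ)))) ∧
    Tendsto (fun n : ℕ => (maxDiameterPairs d n : ℝ) / (n : ℝ) ^ 2) atTop
      (𝓝 ((1 / 2 : ℝ) * (1 - 1 / (antipodalNumber d : ℝ)))) := by
  exact theorem3_general d (by omega)
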